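/- Let $N\ge 1$ be an integer and $\xi\in\mathbb{R}$. Let $\lambda_N(\xi)\in[0,\infty]$ be the supremum of the real numbers $\lambda$ such that the system $$1\le |x|\le X,\qquad \max_{1\le j\le N}|\xi^j x-y_j|\le X^{-\lambda}$$ has a solution $(x,y_1,\dots,y_N)\in\mathbb{Z}^{N+1}$ for arbitrarily large real $X$. Let $w_N(\xi)\in[0,\infty]$, respectively $\widehat{w}_N(\xi)\in[0,\infty]$, be the supremum of the real numbers $w$ such that the system $$\max_{1\le j\le N}|x_j|\le X,\qquad 0<|x_0+\xi x_1+\cdots+\xi^N x_N|\le X^{-w}$$ has a solution $(x_0,\dots,x_N)\in\mathbb{Z}^{N+1}$ for arbitrarily large real $X$, respectively for all sufficiently large real $X$. Let $k\ge n\ge 2$ be integers and let $\xi$ be a real number. Then $$\lambda_k(\xi)\ \ge\ \frac{w_n(\xi)\widehat{w}_n(\xi)-w_n(\xi)+(n-k)\widehat{w}_n(\xi)}{(n-2)\,w_n(\xi)\widehat{w}_n(\xi)+w_n(\xi)+(k-1)\,\widehat{w}_n(\xi)}.$$ Here, if $w_n(\xi)=\infty$ and $\widehat{w}_n(\xi)<\infty$,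 the right-hand side is understood as its limit for $w_n(\xi)\to\infty$, that is, as $\dfrac{\widehat{w}_n(\xi)-1}{(n-2)\widehat{w}_n(\xi)+1}$; if $\widehat{w}_n(\xi)$ is infinite as well, it is understood as the limit $1/(n-2)$ for both quantities tending to infinity (with $1/0=\infty$). If $w_n(\xi)=\widehat{w}_n(\xi)=0$, which happens only for rational $\xi$, the right-hand side is read as $0$. -/

import Mathlib

namespace DiophantineExponent

open Filter

/-- The system `1 ≤ |x| ≤ X`, `max_j |ξ_j x - y_j| ≤ X^(-l)` has an integer solution. -/
def SimultaneousSolvable {N : ℕ} (ξ : Fin N → ℝ) (l X : ℝ) : Prop :=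
  ∃ (x : ℤ) (y : Fin N → ℤ), 1 ≤ |(x : ℝ)| ∧ |(x : ℝ)| ≤ X ∧
    ∀ j, |ξ j * (x : ℝ) - (y j : ℝ)| ≤ X ^ (-l)

/-- The system `max_j |x_j| ≤ X` (over `1 ≤ j ≤ N`),
`0 < |x_0 + ξ_1 x_1 + ⋯ + ξ_N x_N| ≤ X^(-w)` has an integer solution. -/
def LinearFormSolvable {N : ℕ} (ξ : Fin N → ℝ) (w X : ℝ) : Prop :=
  ∃ (x₀ : ℤ) (x : Fin N → ℤ), (∀ j, |(x j : ℝ)| ≤ X) ∧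
    0 < |(x₀ : ℝ) + ∑ j, ξ j * (x j : ℝ)| ∧
    |(x₀ : ℝ) + ∑ j, ξ j * (x j : ℝ)| ≤ X ^ (-w)

/-- Ordinary exponent of simultaneous approximation: supremum in `[-∞, ∞]` of the real `l` for
which the system is solvable for arbitrarily large `X`. -/
noncomputable def simExp {N : ℕ} (ξ : Fin N → ℝ) : EReal :=
  ⨆ (l : ℝ) (_ : ∃ᶠ X in atTop, SimultaneousSolvable ξ l X), (l : EReal)

/-- Ordinary exponent of linear form approximation: solvability for arbitrarily large `X`. -/
noncomputable def linExp {N : ℕ} (ξ : Fin N → ℝ) : EReal :=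
  ⨆ (w : ℝ) (_ : ∃ᶠ X in atTop, LinearFormSolvable ξ w X), (w : EReal)

/-- Uniform exponent of linear form approximation: solvability for all large `X`. -/
noncomputable def uniformLinExp {N : ℕ} (ξ : Fin N → ℝ) : EReal :=
  ⨆ (w : ℝ) (_ : ∀ᶠ X in atTop, LinearFormSolvable ξ w X), (w : EReal)

/-- The point `(ξ, ξ^2, …, ξ^N)` on the Veronese curve. -/
def veronese (N : ℕ) (ξ : ℝ) : Fin N → ℝ := fun j => ξ ^ ((j : ℕ) + 1)

/-- `λ_N(ξ)` -/
noncomputable def lambdaExp (N : ℕ) (ξ : ℝ) : EReal := simExp (veronese N ξ)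

/-- `w_N(ξ)` -/
noncomputable def wExp (N : ℕ) (ξ : ℝ) : EReal := linExp (veronese N ξ)

/-- `ŵ_N(ξ)` -/
noncomputable def wHatExp (N : ℕ) (ξ : ℝ) : EReal := uniformLinExp (veronese N ξ)

open Classical in
/-- The quantity `(w v - w + (n-k) v) / ((n-2) w v + w + (k-1) v)` for finite `w`, `v`.
For `w = ∞` and finite `v` it is the limit as `w → ∞`; for `v = ∞` (which is only of interest if
also `w = ∞`) it is the limit as `w, v → ∞`. -/
noncomputable def mixedBound (n k : ℕ) (w v : EReal) : EReal :=
  if v = ⊤ then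
    if n = 2 then ⊤ else ((1 / ((n : ℝ) - 2) : ℝ) : EReal)
  else if w = ⊤ then
    (((v.toReal - 1) / (((n : ℝ) - 2) * v.toReal + 1) : ℝ) : EReal)
  else
    (((w.toReal * v.toReal - w.toReal + ((n : ℝ) - k) * v.toReal) /
      (((n : ℝ) - 2) * w.toReal * v.toReal + w.toReal + ((k : ℝ) - 1) * v.toReal) : ℝ) : EReal)

end DiophantineExponent

/-! Fix exponents v ≤ w with 1 < v, with the linear form system solvable at some large h for w and
at all large heights for v. Among polynomials of degree at most n whose value at ξ is nonzero and at
most h^(-w), take `P` of least nonconstant height, and put η = |P(ξ)|. Uniform solvability at H =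
(2/η)^(1/v) gives `Q` with 0 < |Q(ξ)| < η. If deg P = n, minimality forbids `Q` to be a multiple of
`P`; if deg P < n, T^(k-n+1)P takes the role of `Q` (`exists_polynomial_pair`).

Thus P, TP, …, T^(k-n)P, Q are k-n+2 independent integer forms in k+1 variables, all small at (1, ξ,
…, ξ^k). Complete them by n-1 coordinate forms and apply Minkowski's theorem: at the resulting
integer point the integer forms have absolute value below 1, so they vanish, and the n-1 selected
coordinates control all others (`exists_int_vector_of_small_forms`). The point is a simultaneous
approximation to the powers of ξ.

It remains to choose the error size δ. In logarithms the requirements are linear, and the worst case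
η = h^(-w) yields exactly the stated quotient (`exists_parameter`). Approaching the two exponents,
finite or infinite, finishes the proof (`le_lambdaExp_of_exponents`). -/

open Matrix MeasureTheory

/-! ### Geometry of numbers: Minkowski's theorem for linear forms -/

/-- Minkowski's theorem on linear forms, with all bounds equal to one. -/
theorem exists_int_vector_abs_mulVec_lt_one {ι : Type*} [Fintype ι] [DecidableEq ι]
    (A : Matrix ι ι ℝ) (h0 : A.det ≠ 0) (h1 : |A.det| < 1) :
    ∃ z : ι → ℤ, z ≠ 0 ∧ ∀ i, |(A *ᵥ fun j => (z j : ℝ)) i| < 1 := by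
  classical
  set b := Pi.basisFun ℝ ι
  have fund := ZSpan.isAddFundamentalDomain' b (volume : Measure (ι → ℝ))
  -- The preimage of the open cube has volume 2^d / |det A|, strictly above 2^d, so the version of
  -- Minkowski's theorem with strict volume inequality applies.
  set s : Set (ι → ℝ) := (toLin' A) ⁻¹' (Set.pi Set.univ fun _ => Set.Ioo (-1 : ℝ) 1) with hs
  have hsymm : ∀ x ∈ s, -x ∈ s := by
    intro x hx
    simp only [hs, Set.mem_preimage, Set.mem_pi, Set.mem_univ, forall_true_left, Set.mem_Ioo,
      map_neg, Pi.neg_apply] at hx ⊢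
    exact fun i => ⟨by linarith [(hx i).2], by linarith [(hx i).1]⟩
  have hconv : Convex ℝ s :=
    (convex_pi fun _ _ => convex_Ioo _ _).linear_preimage _
  have hvol : (volume : Measure (ι → ℝ)) s =
      ENNReal.ofReal |A.det⁻¹| * 2 ^ Fintype.card ι := by
    rw [hs, Measure.addHaar_preimage_linearMap _ (by simpa [LinearMap.det_toLin'] using h0)]
    simp only [LinearMap.det_toLin', volume_pi_pi, Real.volume_Ioo, Finset.prod_const,
      Finset.card_univ]
    norm_num
  have hfd : (volume : Measure (ι → ℝ)) (ZSpan.fundamentalDomain b) = 1 := by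
    rw [ZSpan.volume_fundamentalDomain]
    have : Matrix.of (b : ι → ι → ℝ) = 1 := by
      ext i j
      simp [b, Matrix.one_apply, Pi.single_apply, eq_comm]
    simp [this]
  have hlt : (volume : Measure (ι → ℝ)) (ZSpan.fundamentalDomain b) *
      2 ^ Module.finrank ℝ (ι → ℝ) < volume s := by
    rw [hfd, hvol, Module.finrank_fintype_fun_eq_card]
    refine ENNReal.mul_lt_mul_left (by simp) (by simp) ?_
    rw [← ENNReal.ofReal_one, ENNReal.ofReal_lt_ofReal_iff (by positivity), abs_inv]
    exact (one_lt_inv₀ (abs_pos.mpr h0)).2 h1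
  have : Countable (Submodule.span ℤ (Set.range b)).toAddSubgroup :=
    inferInstanceAs (Countable (Submodule.span ℤ (Set.range b)))
  obtain ⟨⟨x, hxL⟩, hx0, hxs⟩ :=
    exists_ne_zero_mem_lattice_of_measure_mul_two_pow_lt_measure fund hsymm hconv hlt
  have hint : ∀ i, ∃ c : ℤ, (c : ℝ) = x i := by
    intro i
    have := (b.mem_span_iff_repr_mem ℤ x).1 hxL i
    simpa [b] using this
  choose z hz using hint
  have hzx : (fun j => (z j : ℝ)) = x := funext hz
  refine ⟨z, ?_, ?_⟩
  · rintro rfl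
    apply hx0
    ext i
    simpa using (hz i).symm
  · intro i
    rw [hzx]
    simp only [hs, Set.mem_preimage, Set.mem_pi, Set.mem_univ, forall_true_left, Set.mem_Ioo,
      toLin'_apply] at hxs
    exact abs_lt.2 (hxs i)

/-! ### Completing independent forms by coordinate forms -/

/-- The matrix with rows `M a` and, for each `b`, the coordinate form of index `g b`. -/
noncomputable def coordinateCompletion {α β κ : Type*} [DecidableEq κ] (e : α ⊕ β ≃ κ)
    (M : α → κ → ℝ) (g : β → κ) : Matrix κ κ ℝ :=
  Matrix.of fun i => Sum.elim M (fun b => Pi.single (g b) 1) (e.symm i)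

section Completion

variable {α β κ : Type*} [Fintype α] [Fintype β] [Fintype κ] [DecidableEq κ]

/-- With the rows `M` fixed, the determinant is multilinear in the remaining rows. If it vanished on
all tuples of coordinate forms it would vanish identically, contradicting the extension of `M` to a
basis. -/
theorem exists_det_coordinateCompletion_ne_zero (e : α ⊕ β ≃ κ) (M : α → κ → ℝ)
    (hM : LinearIndependent ℝ M) : ∃ g : β → κ, (coordinateCompletion e M g).det ≠ 0 := by
  classical
  by_contra! hzero
  let F := ((Matrix.detRowAlternating (R := ℝ) (n := κ)).toMultilinearMap.domDomCongr
    e.symm).currySum M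
  have hF : F = 0 := by
    refine Module.Basis.ext_multilinear (fun _ => Pi.basisFun ℝ κ) fun g => ?_
    have := hzero g
    simp only [F, MultilinearMap.currySum_apply, MultilinearMap.domDomCongr_apply,
      _root_.zero_apply, AlternatingMap.coe_multilinearMap]
    rw [← this]
    refine congrArg Matrix.det (funext fun i => ?_)
    change _ = Sum.elim M (fun b => Pi.single (g b) 1) (e.symm i)
    rcases e.symm i with a | b <;> simp
  let B := Module.Basis.sumExtend hM
  have : Finite (α ⊕ Module.Basis.sumExtendIndex hM) := Module.Finite.finite_basis B
  have : Finite (Module.Basis.sumExtendIndex hM) := Finite.of_injective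
    (Sum.inr : _ → α ⊕ Module.Basis.sumExtendIndex hM) Sum.inr_injective
  have := Fintype.ofFinite (Module.Basis.sumExtendIndex hM)
  have hcard : Fintype.card β = Fintype.card (Module.Basis.sumExtendIndex hM) := by
    have h1 := Module.finrank_eq_card_basis B
    rw [Module.finrank_fintype_fun_eq_card, ← Fintype.card_congr e, Fintype.card_sum,
      Fintype.card_sum] at h1
    omega
  let f := Fintype.equivOfCardEq hcard
  have hval := congrArg (fun G => G fun b => B (Sum.inr (f b))) hF
  simp only [F, MultilinearMap.currySum_apply, MultilinearMap.domDomCongr_apply,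
      _root_.zero_apply, AlternatingMap.coe_multilinearMap] at hval
  let B' := B.reindex ((Equiv.sumCongr (Equiv.refl α) f.symm).trans e)
  have hB' : LinearIndependent ℝ (Matrix.of fun i => B' i).row := B'.linearIndependent
  rw [Matrix.linearIndependent_rows_iff_isUnit, Matrix.isUnit_iff_isUnit_det] at hB'
  refine hB'.ne_zero ?_
  rw [← hval]
  refine congrArg Matrix.det (funext fun i => ?_)
  change B' i = _
  have hBl : ∀ a, B (Sum.inl a) = M a := fun a => by
    simp only [B, Module.Basis.sumExtend, Module.Basis.reindex_apply,
      Module.Basis.extend_apply_self]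
    rfl
  simp only [B', Module.Basis.reindex_apply]
  rcases h : e.symm i with a | b <;> simp [h, hBl]

/-- Linear independent forms can be completed by coordinate forms such that the common zeros of
the given forms are controlled by the selected coordinates. -/
theorem exists_coordinateCompletion_bound (e : α ⊕ β ≃ κ) (M : α → κ → ℝ)
    (hM : LinearIndependent ℝ M) :
    ∃ g : β → κ, (coordinateCompletion e M g).det ≠ 0 ∧
      ∀ u : κ → ℝ, (∀ a, M a ⬝ᵥ u = 0) → (∀ b, |u (g b)| ≤ 1) →
        ∀ j, |u j| ≤ Fintype.card β := by
  classical
  obtain ⟨g₀, hg₀⟩ := exists_det_coordinateCompletion_ne_zero e M hM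
  have : Nonempty (β → κ) := ⟨g₀⟩
  -- Maximality of the determinant makes every ratio in Cramer's rule at most 1: the relevant
  -- adjugate entries are determinants of other completions.
  obtain ⟨g, hg⟩ := Finite.exists_max fun g : β → κ => |(coordinateCompletion e M g).det|
  have hpos : 0 < |(coordinateCompletion e M g).det| :=
    (abs_pos.2 hg₀).trans_le (hg g₀)
  refine ⟨g, abs_pos.1 hpos, fun u hu hub j => ?_⟩
  set D := coordinateCompletion e M g with hD
  have hDu : ∀ i, (D *ᵥ u) (e i) = Sum.elim (fun _ => 0) (fun b => u (g b)) i := by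
    rintro (a | b)
    · simpa [hD, coordinateCompletion, Matrix.mulVec] using hu a
    · simp [hD, coordinateCompletion, Matrix.mulVec]
  have hadj : ∀ b, |D.adjugate j (e (Sum.inr b))| ≤ |D.det| := by
    intro b
    have hup : D.updateRow (e (Sum.inr b)) (Pi.single j 1) =
        coordinateCompletion e M (Function.update g b j) := ?_
    · rw [Matrix.adjugate_apply, hup]
      exact hg _
    refine Matrix.ext fun i c => ?_
    by_cases hi : i = e (Sum.inr b)
    · subst hi
      simp [coordinateCompletion]
    · rw [Matrix.updateRow_ne hi]
      obtain ⟨i, rfl⟩ := e.surjective i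
      rcases i with a | b'
      · simp [hD, coordinateCompletion]
      · have : b' ≠ b := fun h => hi (by rw [h])
        simp [hD, coordinateCompletion, this]
  have hkey : D.det * u j = ∑ b, D.adjugate j (e (Sum.inr b)) * u (g b) := by
    have h1 : (D.adjugate *ᵥ (D *ᵥ u)) j = D.det * u j := by
      rw [Matrix.mulVec_mulVec, Matrix.adjugate_mul, Matrix.smul_mulVec, Matrix.one_mulVec]
      simp
    rw [← h1, Matrix.mulVec, dotProduct, ← e.sum_comp, Fintype.sum_sum_type]
    simp [hDu]
  have hle : |D.det| * |u j| ≤ |D.det| * Fintype.card β := by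
    rw [← abs_mul, hkey]
    refine (Finset.abs_sum_le_sum_abs _ _).trans ?_
    have : ∀ b ∈ Finset.univ, |D.adjugate j (e (Sum.inr b)) * u (g b)| ≤ |D.det| := by
      intro b _
      rw [abs_mul]
      exact (mul_le_mul (hadj b) (hub b) (abs_nonneg _) (abs_nonneg _)).trans (by simp)
    refine (Finset.sum_le_sum this).trans ?_
    simp [mul_comm]
  exact le_of_mul_le_mul_left hle hpos

theorem abs_det_le_factorial_mul_prod (A : Matrix κ κ ℝ) (b : κ → ℝ)
    (h : ∀ i j, |A i j| ≤ b i) :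
    |A.det| ≤ (Fintype.card κ).factorial * ∏ i, b i := by
  rw [Matrix.det_apply]
  refine (Finset.abs_sum_le_sum_abs _ _).trans ?_
  have : ∀ σ ∈ (Finset.univ : Finset (Equiv.Perm κ)),
      |Equiv.Perm.sign σ • ∏ i, A (σ i) i| ≤ ∏ i, b i := by
    intro σ _
    have h1 : |Equiv.Perm.sign σ • ∏ i, A (σ i) i| = ∏ i, |A (σ i) i| := by
      rw [← Finset.abs_prod]
      rcases Int.units_eq_one_or (Equiv.Perm.sign σ) with h | h <;> simp [h]
    rw [h1, ← Equiv.prod_comp σ b]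
    exact Finset.prod_le_prod (fun _ _ => abs_nonneg _) fun i _ => h _ _
  refine (Finset.sum_le_sum this).trans ?_
  simp [Fintype.card_perm]

end Completion

/-! ### From small integer forms to simultaneous approximation -/

/-- If `R` is a family of independent integer linear forms, small relative to `ξ`, then there is a
nonzero integer point that gives good simultaneous approximations to `ξ`. -/
theorem exists_int_vector_of_small_forms {α : Type*} [Fintype α] {k r : ℕ}
    (hcard : Fintype.card α + r = k + 1) (ξ : Fin k → ℝ) (R : α → Fin (k + 1) → ℤ)
    (hR : LinearIndependent ℝ fun a j => (R a j : ℝ)) {X δ : ℝ} (hX : 0 < X) (hδ : 0 < δ)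
    (b : α → ℝ) (hb0 : ∀ a, X * |(R a 0 : ℝ) + ∑ j, ξ j * (R a j.succ : ℝ)| ≤ b a)
    (hb : ∀ a (j : Fin k), δ * |(R a j.succ : ℝ)| ≤ b a)
    (hsmall : ((k + 1).factorial : ℝ) * ∏ a, b a < X * δ ^ k) :
    ∃ z : Fin (k + 1) → ℤ, z ≠ 0 ∧ |(z 0 : ℝ)| ≤ r * X ∧
      ∀ j : Fin k, |ξ j * (z 0 : ℝ) - (z j.succ : ℝ)| ≤ r * δ := by
  classical
  let e : α ⊕ Fin r ≃ Fin (k + 1) := Fintype.equivOfCardEq (by simp [hcard])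
  -- These are the forms `R` written in the coordinates u = U z below, namely z 0 / X and (ξ j * z 0
  -- - z j.succ) / δ; the identity is `hMU`.
  let M : α → Fin (k + 1) → ℝ := fun a => Fin.cons (X * ((R a 0 : ℝ) + ∑ j, ξ j * (R a j.succ : ℝ)))
    fun j => -δ * (R a j.succ : ℝ)
  have hM : LinearIndependent ℝ M := by
    rw [Fintype.linearIndependent_iff] at hR ⊢
    intro c hc
    apply hR c
    have hs : ∀ j : Fin k, ∑ a, c a * (R a j.succ : ℝ) = 0 := by
      intro j
      have := congrFun hc j.succ
      simp only [M, Finset.sum_apply, Pi.smul_apply, Fin.cons_succ, smul_eq_mul,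
        Pi.zero_apply] at this
      have h2 : -δ * ∑ a, c a * (R a j.succ : ℝ) = 0 := by
        rw [← this, Finset.mul_sum]
        exact Finset.sum_congr rfl fun _ _ => by ring
      simpa [hδ.ne'] using h2
    have h0 : ∑ a, c a * (R a 0 : ℝ) = 0 := by
      have := congrFun hc 0
      simp only [M, Finset.sum_apply, Pi.smul_apply, Fin.cons_zero, smul_eq_mul,
        Pi.zero_apply] at this
      have h2 : X * (∑ a, c a * (R a 0 : ℝ) + ∑ j, ξ j * ∑ a, c a * (R a j.succ : ℝ)) = 0 := by
        rw [← this]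
        simp only [Finset.mul_sum, mul_add, Finset.sum_add_distrib]
        rw [Finset.sum_comm]
        congr 1
        · exact Finset.sum_congr rfl fun _ _ => by ring
        · exact Finset.sum_congr rfl fun _ _ => Finset.sum_congr rfl fun _ _ => by ring
      simpa [hs, hX.ne'] using h2
    ext j
    refine Fin.cases ?_ (fun j => ?_) j
    · simpa using h0
    · simpa using hs j
  obtain ⟨g, hdet, hg⟩ := exists_coordinateCompletion_bound e M hM
  set D := coordinateCompletion e M g with hD
  let U : Matrix (Fin (k + 1)) (Fin (k + 1)) ℝ := Matrix.of (Fin.cons (Pi.single 0 X⁻¹)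
    fun j => Fin.cons (δ⁻¹ * ξ j) (Pi.single j (-δ⁻¹)))
  have hU0 : ∀ z : Fin (k + 1) → ℝ, (U *ᵥ z) 0 = z 0 / X := by
    intro z
    simp [U, Matrix.mulVec, dotProduct, Fin.sum_univ_succ]
    field_simp
  have hUs : ∀ (z : Fin (k + 1) → ℝ) (j : Fin k),
      (U *ᵥ z) j.succ = (ξ j * z 0 - z j.succ) / δ := by
    intro z j
    simp [U, Matrix.mulVec, dotProduct, Fin.sum_univ_succ, Pi.single_apply]
    field_simp
    ring
  have hUdet : U.det = X⁻¹ * (-δ⁻¹) ^ k := by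
    rw [Matrix.det_of_isLowerTriangular U, Fin.prod_univ_succ]
    · simp [U]
    · intro i j hij
      have hij : i < j := hij
      induction i using Fin.cases with
      | zero => simp [U, hij.ne']
      | succ i =>
        induction j using Fin.cases with
        | zero => simp at hij
        | succ j =>
          have : i < j := by simpa using hij
          simp [U, this.ne']
  have hMU : ∀ (z : Fin (k + 1) → ℝ) a, M a ⬝ᵥ (U *ᵥ z) = ∑ j, (R a j : ℝ) * z j := by
    intro z a
    rw [dotProduct, Fin.sum_univ_succ, Fin.sum_univ_succ]
    simp only [hU0, hUs, M, Fin.cons_zero, Fin.cons_succ]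
    have h1 : ∀ j : Fin k, -δ * (R a j.succ : ℝ) * ((ξ j * z 0 - z j.succ) / δ) =
        (R a j.succ : ℝ) * z j.succ - z 0 * (ξ j * (R a j.succ : ℝ)) := by
      intro j
      field_simp
      ring
    simp only [h1, Finset.sum_sub_distrib, ← Finset.mul_sum]
    field_simp
    ring
  have hDle : |D.det| ≤ (k + 1).factorial * ∏ a, b a := by
    have := abs_det_le_factorial_mul_prod D
      (fun i => Sum.elim b (fun _ => (1 : ℝ)) (e.symm i)) ?_
    · rw [Equiv.prod_comp e.symm (fun i => Sum.elim b (fun _ => (1 : ℝ)) i)] at this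
      simpa using this
    · intro i j
      obtain ⟨i, rfl⟩ := e.surjective i
      rcases i with a | c
      · simp only [hD, coordinateCompletion, Matrix.of_apply, Equiv.symm_apply_apply,
          Sum.elim_inl]
        refine Fin.cases ?_ (fun j => ?_) j
        · simpa [M, abs_mul, abs_of_pos hX] using hb0 a
        · simpa [M, abs_mul, abs_of_pos hδ] using hb a j
      · simp only [hD, coordinateCompletion, Matrix.of_apply, Equiv.symm_apply_apply,
          Sum.elim_inr, Pi.single_apply]
        split_ifs <;> simp
  have hA : (D * U).det ≠ 0 := by
    rw [Matrix.det_mul, hUdet]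
    exact mul_ne_zero hdet (mul_ne_zero (inv_ne_zero hX.ne')
      (pow_ne_zero _ (neg_ne_zero.2 (inv_ne_zero hδ.ne'))))
  have hA1 : |(D * U).det| < 1 := by
    rw [Matrix.det_mul, hUdet, abs_mul, abs_mul, abs_pow, abs_neg, abs_inv, abs_inv,
      abs_of_pos hX, abs_of_pos hδ]
    calc |D.det| * (X⁻¹ * δ⁻¹ ^ k) < X * δ ^ k * (X⁻¹ * δ⁻¹ ^ k) :=
          mul_lt_mul_of_pos_right (hDle.trans_lt hsmall) (by positivity)
      _ = 1 := by
          rw [inv_pow]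
          field_simp
  obtain ⟨z, hz0, hz⟩ := exists_int_vector_abs_mulVec_lt_one (D * U) hA hA1
  set u := U *ᵥ fun j => (z j : ℝ) with hu
  have hz' : ∀ i, |(D *ᵥ u) (e i)| < 1 := fun i => by
    simpa [hu, Matrix.mulVec_mulVec] using hz (e i)
  have hbound := hg u ?_ ?_
  · refine ⟨z, hz0, ?_, fun j => ?_⟩
    · have := hbound 0
      rw [hu, hU0, abs_div, abs_of_pos hX, div_le_iff₀ hX] at this
      simpa using this
    · have := hbound j.succ
      rw [hu, hUs, abs_div, abs_of_pos hδ, div_le_iff₀ hδ] at this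
      simpa using this
  · intro a
    have h1 : |M a ⬝ᵥ u| < 1 := by
      simpa [hD, coordinateCompletion, Matrix.mulVec] using hz' (Sum.inl a)
    rw [hu, hMU] at h1 ⊢
    -- Integrality enters here: the value is an integer of absolute value below 1, hence 0.
    have h2 : |∑ j, R a j * z j| < 1 := by exact_mod_cast h1
    exact_mod_cast Int.abs_lt_one_iff.1 h2
  · intro c
    have h1 := hz' (Sum.inr c)
    simp [hD, coordinateCompletion, Matrix.mulVec] at h1
    exact h1.le

/-! ### Integer polynomials with small value at ξ -/

section Polynomials

open Polynomial DiophantineExponent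

/-- The largest absolute value of the coefficients of `P` of index between `1` and `n`. -/
noncomputable def nonconstantHeight (n : ℕ) (P : ℤ[X]) : ℕ :=
  (Finset.Icc 1 n).sup fun j => (P.coeff j).natAbs

theorem abs_coeff_le_nonconstantHeight {n j : ℕ} (P : ℤ[X]) (hj : 1 ≤ j) (hjn : j ≤ n) :
    |(P.coeff j : ℝ)| ≤ nonconstantHeight n P := by
  have h : (P.coeff j).natAbs ≤ nonconstantHeight n P :=
    Finset.le_sup (f := fun j => (P.coeff j).natAbs) (Finset.mem_Icc.2 ⟨hj, hjn⟩)
  rw [← Int.cast_abs, Int.abs_eq_natAbs]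
  exact_mod_cast h

theorem nonconstantHeight_le {n : ℕ} {P : ℤ[X]} {h : ℝ} (h0 : 0 ≤ h)
    (hP : ∀ j, 1 ≤ j → j ≤ n → |(P.coeff j : ℝ)| ≤ h) : (nonconstantHeight n P : ℝ) ≤ h := by
  rw [← Nat.le_floor_iff h0]
  refine Finset.sup_le fun j hj => ?_
  rw [Finset.mem_Icc] at hj
  rw [Nat.le_floor_iff h0]
  simpa [Nat.cast_natAbs] using hP j hj.1 hj.2

theorem aeval_eq_coeff_zero_add_sum {m : ℕ} (ξ : ℝ) {P : ℤ[X]} (hP : P.natDegree ≤ m) :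
    aeval ξ P = (P.coeff 0 : ℝ) + ∑ j : Fin m, ξ ^ ((j : ℕ) + 1) * (P.coeff (j + 1) : ℝ) := by
  rw [aeval_eq_sum_range' (Nat.lt_succ_of_le hP), Finset.sum_range_succ', add_comm,
    ← Fin.sum_univ_eq_sum_range (fun j => P.coeff (j + 1) • ξ ^ (j + 1))]
  simp [mul_comm]

theorem LinearFormSolvable.exists_polynomial {n : ℕ} {ξ w h : ℝ} (h0 : 0 ≤ h)
    (hs : LinearFormSolvable (veronese n ξ) w h) :
    ∃ P : ℤ[X], P.natDegree ≤ n ∧ (nonconstantHeight n P : ℝ) ≤ h ∧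
      0 < |aeval ξ P| ∧ |aeval ξ P| ≤ h ^ (-w) := by
  obtain ⟨x₀, x, hx, hpos, hle⟩ := hs
  let P : ℤ[X] := ofFn (n + 1) (Fin.cons x₀ x)
  have hdeg : P.natDegree ≤ n := Nat.lt_succ_iff.1 (ofFn_natDegree_lt (by simp) _)
  have hc0 : P.coeff 0 = x₀ := by
    simp [P, ofFn_coeff_eq_val_of_lt (i := 0) _ (Nat.succ_pos n)]
  have hcs : ∀ j : Fin n, P.coeff ((j : ℕ) + 1) = x j := fun j => by
    have := ofFn_coeff_eq_val_of_lt (i := (j : ℕ) + 1) (Fin.cons x₀ x : Fin (n + 1) → ℤ)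
      (by omega)
    rw [this]
    exact Fin.cons_succ (α := fun _ => ℤ) x₀ x j
  have heval : aeval ξ P = (x₀ : ℝ) + ∑ j, veronese n ξ j * (x j : ℝ) := by
    rw [aeval_eq_coeff_zero_add_sum ξ hdeg, hc0]
    simp [hcs, veronese]
  refine ⟨P, hdeg, nonconstantHeight_le h0 fun j hj hjn => ?_, by rwa [heval], by rwa [heval]⟩
  have := hx ⟨j - 1, by omega⟩
  rwa [← hcs, Nat.sub_add_cancel hj] at this

/-- A relation among these polynomials reads A * P + c • Q = 0 with deg A < m. If c ≠ 0, then `Q` is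
an excluded multiple of `P`; if c = 0, then A = 0. -/
theorem linearIndependent_shifts (m : ℕ) (P Q : ℝ[X]) (hP : P ≠ 0)
    (hQ : ∀ A : ℝ[X], A.degree < m → Q ≠ A * P) :
    LinearIndependent ℝ
      (Sum.elim (fun i : Fin m => X ^ (i : ℕ) * P) (fun _ : Unit => Q)) := by
  rw [Fintype.linearIndependent_iff]
  intro c hc
  rw [Fintype.sum_sum_type] at hc
  simp only [Sum.elim_inl, Sum.elim_inr, Finset.univ_unique, Finset.sum_singleton,
    PUnit.default_eq_unit] at hc
  set A : ℝ[X] := ∑ i : Fin m, c (Sum.inl i) • X ^ (i : ℕ) with hA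
  have hAdeg : A.degree < m := by
    rw [degree_lt_iff_coeff_zero]
    intro j hj
    simp only [hA, finsetSum_coeff, coeff_smul, coeff_X_pow]
    refine Finset.sum_eq_zero fun i _ => ?_
    have : j ≠ i := by omega
    simp [this]
  have hAP : A * P + c (Sum.inr ()) • Q = 0 := by
    rw [← hc, hA, Finset.sum_mul]
    simp
  have hc0 : c (Sum.inr ()) = 0 := by
    by_contra hne
    refine hQ (-(c (Sum.inr ()))⁻¹ • A) ((degree_smul_le _ _).trans_lt hAdeg) ?_
    have h1 : c (Sum.inr ()) • Q = -(A * P) := by linear_combination hAP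
    rw [smul_mul_assoc, neg_smul, ← smul_neg, ← h1, smul_smul, inv_mul_cancel₀ hne, one_smul]
  have hA0 : A = 0 := by
    rw [hc0, zero_smul, add_zero] at hAP
    exact (mul_eq_zero.1 hAP).resolve_right hP
  rintro (i | ⟨⟩)
  · have h1 : A.coeff i = c (Sum.inl i) := by
      simp only [hA, finsetSum_coeff, coeff_smul, coeff_X_pow]
      rw [Finset.sum_eq_single i]
      · simp
      · intro b _ hb
        have : (i : ℕ) ≠ b := fun h => hb (Fin.ext h.symm)
        simp [this]
      · simp
    rw [← h1, hA0, coeff_zero]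
  · exact hc0

theorem linearIndependent_coeff {α : Type*} [Fintype α] {k : ℕ} (F : α → ℤ[X])
    (hdeg : ∀ a, (F a).natDegree ≤ k)
    (hF : LinearIndependent ℝ fun a => (F a).map (Int.castRingHom ℝ)) :
    LinearIndependent ℝ fun a (j : Fin (k + 1)) => ((F a).coeff j : ℝ) := by
  rw [Fintype.linearIndependent_iff] at hF ⊢
  intro c hc
  apply hF c
  ext j
  simp only [finsetSum_coeff, coeff_smul, coeff_map, coeff_zero, smul_eq_mul]
  by_cases hj : j < k + 1
  · simpa using congrFun hc ⟨j, hj⟩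
  · refine Finset.sum_eq_zero fun a _ => ?_
    rw [coeff_eq_zero_of_natDegree_lt ((hdeg a).trans_lt (by omega))]
    simp

/-- A constant that bounds the powers of `ξ` up to the exponent `k`. -/
noncomputable def powerBound (k : ℕ) (ξ : ℝ) : ℝ := 1 + ∑ j ∈ Finset.range (k + 1), |ξ| ^ j

theorem one_le_powerBound (k : ℕ) (ξ : ℝ) : 1 ≤ powerBound k ξ :=
  le_add_of_nonneg_right (Finset.sum_nonneg fun _ _ => by positivity)

theorem abs_pow_le_powerBound {i k : ℕ} (hi : i ≤ k) (ξ : ℝ) : |ξ ^ i| ≤ powerBound k ξ := by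
  rw [abs_pow]
  have : |ξ| ^ i ≤ ∑ j ∈ Finset.range (k + 1), |ξ| ^ j :=
    Finset.single_le_sum (f := fun j => |ξ| ^ j) (fun _ _ => by positivity)
      (Finset.mem_range.2 (by omega))
  unfold powerBound
  linarith

/-- Only the constant coefficient needs an argument: it is recovered from the value at ξ and the
other coefficients. Hence it may be left out of the height. -/
theorem abs_coeff_le_powerBound_mul {n k : ℕ} (hk : n ≤ k) {ξ h : ℝ} (h1 : 1 ≤ h) {P : ℤ[X]}
    (hdeg : P.natDegree ≤ n) (hP : (nonconstantHeight n P : ℝ) ≤ h) (hev : |aeval ξ P| ≤ 1)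
    (j : ℕ) : |(P.coeff j : ℝ)| ≤ powerBound k ξ * h := by
  have hC := one_le_powerBound k ξ
  rcases Nat.eq_zero_or_pos j with rfl | hj
  · have h2 := aeval_eq_coeff_zero_add_sum ξ hdeg
    have h3 : |∑ j : Fin n, ξ ^ ((j : ℕ) + 1) * (P.coeff (j + 1) : ℝ)| ≤
        (∑ j ∈ Finset.range (k + 1), |ξ| ^ j) * h := by
      calc _ ≤ ∑ j : Fin n, |ξ| ^ ((j : ℕ) + 1) * h := by
            refine (Finset.abs_sum_le_sum_abs _ _).trans (Finset.sum_le_sum fun j _ => ?_)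
            rw [abs_mul, abs_pow]
            exact mul_le_mul_of_nonneg_left
              ((abs_coeff_le_nonconstantHeight P (by omega) (by omega)).trans hP) (by positivity)
        _ = (∑ j ∈ Finset.range n, |ξ| ^ (j + 1)) * h := by
            rw [Finset.sum_mul, Fin.sum_univ_eq_sum_range (fun j => |ξ| ^ (j + 1) * h)]
        _ ≤ _ := by
            refine mul_le_mul_of_nonneg_right ?_ (by linarith)
            rw [Finset.sum_range_succ']
            have : ∑ j ∈ Finset.range n, |ξ| ^ (j + 1) ≤ ∑ j ∈ Finset.range k, |ξ| ^ (j + 1) :=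
              Finset.sum_le_sum_of_subset_of_nonneg (Finset.range_mono hk)
                fun _ _ _ => by positivity
            simp only [pow_zero]
            linarith
    have h4 : (P.coeff 0 : ℝ) =
        aeval ξ P - ∑ j : Fin n, ξ ^ ((j : ℕ) + 1) * (P.coeff (j + 1) : ℝ) := by
      rw [h2]; ring
    rw [h4]
    refine (abs_sub _ _).trans ?_
    unfold powerBound
    linarith
  · have h0 : (0 : ℝ) ≤ (nonconstantHeight n P : ℝ) := Nat.cast_nonneg _
    rcases le_or_gt j n with hjn | hjn
    · refine ((abs_coeff_le_nonconstantHeight P hj hjn).trans hP).trans ?_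
      nlinarith
    · rw [coeff_eq_zero_of_natDegree_lt (hdeg.trans_lt hjn)]
      simp only [Int.cast_zero, abs_zero]
      positivity

/-- From `P` and `Q`, both small at `ξ`, with `P, TP, …, T^(k-n)P, Q` independent, one gets an
integer point close to the line through `(1, ξ, …, ξ^k)`. -/
theorem exists_int_vector_of_polynomials {n k : ℕ} (hn : 2 ≤ n) (hk : n ≤ k) {ξ h H η X₀ δ : ℝ}
    (h1 : 1 ≤ h) (hη : 0 < η) (hη1 : η ≤ 1) (hδ : 0 < δ)
    {P Q : ℤ[X]} (hPdeg : P.natDegree ≤ n) (hQdeg : Q.natDegree ≤ k)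
    (hPh : (nonconstantHeight n P : ℝ) ≤ h) (hPη : |aeval ξ P| = η)
    (hhH : h ≤ H) (hQh : ∀ j, 1 ≤ j → |(Q.coeff j : ℝ)| ≤ powerBound k ξ * H)
    (hQη : |aeval ξ Q| ≤ powerBound k ξ * η)
    (hind : ∀ A : ℝ[X], A.degree < (k - n + 1 : ℕ) →
      Q.map (Int.castRingHom ℝ) ≠ A * P.map (Int.castRingHom ℝ))
    (hX : X₀ * η = δ * h)
    (hsmall : ((k + 1).factorial : ℝ) * powerBound k ξ ^ (k - n + 2) * h ^ (k - n) * η * H <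
      δ ^ (n - 1)) :
    ∃ z : Fin (k + 1) → ℤ, z ≠ 0 ∧ |(z 0 : ℝ)| ≤ (n - 1 : ℕ) * X₀ ∧
      ∀ j : Fin k, |veronese k ξ j * (z 0 : ℝ) - (z j.succ : ℝ)| ≤ (n - 1 : ℕ) * δ := by
  set C := powerBound k ξ
  have hC : 1 ≤ C := one_le_powerBound k ξ
  have hX0 : 0 < X₀ := pos_of_mul_pos_left (hX ▸ mul_pos hδ (by linarith)) hη.le
  let F : Fin (k - n + 1) ⊕ Unit → ℤ[X] :=
    Sum.elim (fun i => Polynomial.X ^ (i : ℕ) * P) (fun _ => Q)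
  have hFdeg : ∀ a, (F a).natDegree ≤ k := by
    rintro (i | _)
    · refine natDegree_mul_le.trans ?_
      rw [natDegree_X_pow]
      omega
    · exact hQdeg
  have hP0 : P ≠ 0 := by
    rintro rfl
    simp at hPη
    linarith
  have hFind : LinearIndependent ℝ fun a => (F a).map (Int.castRingHom ℝ) := by
    convert linearIndependent_shifts (k - n + 1) _ _ ?_ hind using 1
    · funext a
      rcases a with i | _ <;> simp [F]
    · exact (Polynomial.map_ne_zero_iff Int.cast_injective).2 hP0
  have heval : ∀ a, ((F a).coeff ((0 : Fin (k + 1)) : ℕ) : ℝ) +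
      ∑ j : Fin k, veronese k ξ j * ((F a).coeff (j.succ : ℕ) : ℝ) = aeval ξ (F a) := by
    intro a
    rw [aeval_eq_coeff_zero_add_sum ξ (hFdeg a)]
    simp [veronese]
  -- There are k-n+2 forms in k+1 variables, which leaves n-1 coordinate forms. The relation `hX`
  -- balances the value and coefficient bounds of the shifts of `P`.
  refine exists_int_vector_of_small_forms (α := Fin (k - n + 1) ⊕ Unit) (r := n - 1)
    (by simp; omega) (veronese k ξ)
    (fun a j => (F a).coeff j) (linearIndependent_coeff F hFdeg hFind) hX0 hδ
    (Sum.elim (fun _ => C * δ * h) fun _ => C * δ * H) ?_ ?_ ?_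
  · intro a
    rw [heval]
    rcases a with i | _
    · simp only [F, Sum.elim_inl, map_mul, map_pow, aeval_X, abs_mul, hPη]
      calc X₀ * (|ξ ^ (i : ℕ)| * η) = |ξ ^ (i : ℕ)| * (X₀ * η) := by ring
        _ ≤ C * (X₀ * η) := by
          gcongr
          exact abs_pow_le_powerBound (by omega) ξ
        _ = C * δ * h := by rw [hX]; ring
    · simp only [F, Sum.elim_inr]
      calc X₀ * |aeval ξ Q| ≤ X₀ * (C * η) := by gcongr
        _ = C * δ * h := by linear_combination C * hX
        _ ≤ C * δ * H := by gcongr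
  · rintro (i | _) j
    · simp only [F, Sum.elim_inl, coeff_X_pow_mul']
      split_ifs with hij
      · calc _ ≤ δ * (C * h) := by
              gcongr
              exact abs_coeff_le_powerBound_mul hk h1 hPdeg hPh (by rw [hPη]; exact hη1) _
          _ = _ := by ring
      · simp only [Int.cast_zero, abs_zero, mul_zero]
        positivity
    · simp only [F, Sum.elim_inr]
      calc _ ≤ δ * (C * H) := by
            gcongr
            exact hQh _ (by simp)
        _ = _ := by ring
  · rw [Fintype.prod_sum_type]
    simp only [Sum.elim_inl, Sum.elim_inr, Finset.prod_const, Finset.card_univ, Fintype.card_fin,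
      Finset.univ_unique, Finset.card_singleton, pow_one]
    have hXe : X₀ = δ * h / η := by rw [← hX]; field_simp
    have hkp : δ ^ k = δ ^ (k - n + 1) * δ ^ (n - 1) := by
      rw [← pow_add]; congr 1; omega
    have hm : 0 < δ ^ (k - n + 2) * h / η := by positivity
    calc _ = ((k + 1).factorial * C ^ (k - n + 2) * h ^ (k - n) * η * H) *
          (δ ^ (k - n + 2) * h / η) := by field_simp; ring
      _ < δ ^ (n - 1) * (δ ^ (k - n + 2) * h / η) := mul_lt_mul_of_pos_right hsmall hm
      _ = _ := by rw [hXe, hkp]; ring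

/-- If the linear form system is solvable at `h` for `w` and at `H` for `v`, there are two
polynomials as required by `exists_int_vector_of_polynomials`. -/
theorem exists_polynomial_pair {n k : ℕ} (hn : 2 ≤ n) (hk : n ≤ k) {ξ h w : ℝ}
    (h1 : 1 < h) (hw : 0 < w) (hs : LinearFormSolvable (veronese n ξ) w h) (H : ℝ → ℝ)
    (hH : ∀ η, 0 < η → η ≤ h ^ (-w) → h ≤ H η ∧ ∃ Q : ℤ[X], Q.natDegree ≤ n ∧
      (nonconstantHeight n Q : ℝ) ≤ H η ∧ 0 < |aeval ξ Q| ∧ |aeval ξ Q| < η) :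
    ∃ P Q : ℤ[X], P.natDegree ≤ n ∧ Q.natDegree ≤ k ∧ (nonconstantHeight n P : ℝ) ≤ h ∧
      0 < |aeval ξ P| ∧ |aeval ξ P| ≤ h ^ (-w) ∧
      (∀ j, 1 ≤ j → |(Q.coeff j : ℝ)| ≤ powerBound k ξ * H |aeval ξ P|) ∧
      |aeval ξ Q| ≤ powerBound k ξ * |aeval ξ P| ∧
      ∀ A : ℝ[X], A.degree < (k - n + 1 : ℕ) →
        Q.map (Int.castRingHom ℝ) ≠ A * P.map (Int.castRingHom ℝ) := by
  have hC := one_le_powerBound k ξ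
  obtain ⟨P₀, hP₀deg, hP₀h, hP₀pos, hP₀le⟩ := LinearFormSolvable.exists_polynomial (by linarith) hs
  -- The threshold h^(-w) stays fixed during the minimization, so any polynomial with smaller
  -- nonzero value than `P` competes with it.
  let S : Set ℤ[X] := {P | P.natDegree ≤ n ∧ 0 < |aeval ξ P| ∧ |aeval ξ P| ≤ h ^ (-w)}
  obtain ⟨P, ⟨hPdeg, hPpos, hPle⟩, hPmin⟩ :=
    WellFounded.has_min (measure (nonconstantHeight n)).wf S ⟨P₀, hP₀deg, hP₀pos, hP₀le⟩
  have hPh : (nonconstantHeight n P : ℝ) ≤ h := by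
    refine le_trans ?_ hP₀h
    exact_mod_cast not_lt.1 (hPmin P₀ ⟨hP₀deg, hP₀pos, hP₀le⟩)
  have hP1 : |aeval ξ P| ≤ 1 :=
    hPle.trans (Real.rpow_le_one_of_one_le_of_nonpos h1.le (by linarith))
  have hP0 : P ≠ 0 := by
    rintro rfl
    simp at hPpos
  have hP0' : P.map (Int.castRingHom ℝ) ≠ 0 :=
    (Polynomial.map_ne_zero_iff Int.cast_injective).2 hP0
  obtain ⟨hhH, Q, hQdeg, hQh, hQpos, hQlt⟩ := hH _ hPpos hPle
  rcases hPdeg.lt_or_eq with hlt | heq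
  -- As deg P < n, one further shift still has degree at most k.
  · refine ⟨P, Polynomial.X ^ (k - n + 1) * P, hPdeg, ?_, hPh, hPpos, hPle, ?_, ?_, ?_⟩
    · refine natDegree_mul_le.trans ?_
      rw [natDegree_X_pow]
      omega
    · intro j _
      rw [coeff_X_pow_mul']
      split_ifs
      · refine (abs_coeff_le_powerBound_mul hk h1.le hPdeg hPh hP1 _).trans ?_
        gcongr
      · simp only [Int.cast_zero, abs_zero]
        have : 0 < H |aeval ξ P| := by linarith
        positivity
    · simp only [map_mul, map_pow, aeval_X, abs_mul]
      gcongr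
      exact abs_pow_le_powerBound (by omega) ξ
    · intro A hA h2
      rw [Polynomial.map_mul, Polynomial.map_pow, Polynomial.map_X] at h2
      have := mul_right_cancel₀ hP0' h2
      rw [← this, degree_X_pow] at hA
      exact lt_irrefl _ hA
  · refine ⟨P, Q, hPdeg, hQdeg.trans hk, hPh, hPpos, hPle, ?_, ?_, ?_⟩
    · intro j hj
      have h0 : 0 < H |aeval ξ P| := by linarith
      rcases le_or_gt j n with hjn | hjn
      · refine ((abs_coeff_le_nonconstantHeight Q hj hjn).trans hQh).trans ?_
        exact le_mul_of_one_le_left h0.le hC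
      · rw [coeff_eq_zero_of_natDegree_lt (hQdeg.trans_lt hjn)]
        simp only [Int.cast_zero, abs_zero]
        positivity
    · exact hQlt.le.trans (le_mul_of_one_le_left hPpos.le hC)
    -- As deg P = n ≥ deg Q, the factor is a constant s, and |s| < 1 by comparing values at ξ. Then
    -- `Q` has smaller height than `P`; strictness needs a nonzero nonconstant coefficient, here the
    -- leading one.
    · intro A _ h2
      have hQ0 : Q ≠ 0 := by
        rintro rfl
        simp at hQpos
      have hQ0' : Q.map (Int.castRingHom ℝ) ≠ 0 :=
        (Polynomial.map_ne_zero_iff Int.cast_injective).2 hQ0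
      have hA0 : A ≠ 0 := by
        rintro rfl
        exact hQ0' (by simpa using h2)
      have hAdeg : A.natDegree = 0 := by
        have h3 := congrArg natDegree h2
        rw [natDegree_mul hA0 hP0', natDegree_map_eq_of_injective Int.cast_injective,
          natDegree_map_eq_of_injective Int.cast_injective] at h3
        omega
      obtain ⟨s, rfl⟩ : ∃ s, A = Polynomial.C s := ⟨_, eq_C_of_natDegree_eq_zero hAdeg⟩
      have hev : aeval ξ Q = s * aeval ξ P := by
        have h3 := congrArg (Polynomial.eval ξ) h2
        rw [Polynomial.eval_mul, Polynomial.eval_C] at h3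
        simpa [aeval_def, eval_map] using h3
      have hco : ∀ j, (Q.coeff j : ℝ) = s * P.coeff j := fun j => by
        have h3 := congrArg (fun p => Polynomial.coeff p j) h2
        simpa using h3
      have hs1 : |s| < 1 := by
        rw [hev, abs_mul] at hQlt
        by_contra! hge
        exact absurd hQlt (not_lt.2 (le_mul_of_one_le_left hPpos.le hge))
      refine hPmin Q ⟨hQdeg, hQpos, hQlt.le.trans hPle⟩ ?_
      change nonconstantHeight n Q < nonconstantHeight n P
      have hPn : 0 < nonconstantHeight n P := by
        have h3 := abs_coeff_le_nonconstantHeight P (show 1 ≤ n by omega) le_rfl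
        have h4 : P.coeff n ≠ 0 := by
          rw [← heq]
          exact leadingCoeff_ne_zero.2 hP0
        have h5 : (0 : ℝ) < nonconstantHeight n P :=
          lt_of_lt_of_le (abs_pos.2 (by exact_mod_cast h4)) h3
        exact_mod_cast h5
      refine (Finset.sup_lt_iff hPn).2 fun j hj => ?_
      rw [Finset.mem_Icc] at hj
      have h3 : ((Q.coeff j).natAbs : ℝ) < nonconstantHeight n P := by
        rw [Nat.cast_natAbs, Int.cast_abs, hco, abs_mul]
        have h4 := abs_coeff_le_nonconstantHeight P hj.1 hj.2
        have h5 : (0 : ℝ) < nonconstantHeight n P := by exact_mod_cast hPn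
        nlinarith [abs_nonneg s, abs_nonneg (P.coeff j : ℝ)]
      exact_mod_cast h3

end Polynomials

/-! ### Choice of parameters and passage to the exponents -/

section Exponents

open DiophantineExponent Filter

/-- The parameters for `exists_int_vector_of_polynomials`: `δ` can be chosen such that the
resulting point satisfies the simultaneous system with exponent `l`. -/
theorem exists_parameter {n k : ℕ} (hn : 2 ≤ n) (hk : n ≤ k) {l w v K : ℝ} (hw : 0 < w) (hv : 1 < v)
    (hl : 0 ≤ l) (hK : 1 ≤ K)
    (hlwv : l * (((n : ℝ) - 2) * w * v + w + ((k : ℝ) - 1) * v) <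
      w * v - w + ((n : ℝ) - k) * v) :
    ∃ h₀ : ℝ, 1 < h₀ ∧ ∀ h η : ℝ, h₀ ≤ h → 0 < η → η ≤ h ^ (-w) → η ≤ 1 →
      ∃ δ : ℝ, 0 < δ ∧ h ≤ δ * h / η ∧
        K * h ^ (k - n) * η * (2 / η) ^ v⁻¹ < δ ^ (n - 1) ∧
        (n - 1 : ℕ) * δ < ((n - 1 : ℕ) * (δ * h / η)) ^ (-l) := by
  have hv0 : 0 < v := by linarith
  set N : ℝ := ((n - 1 : ℕ) : ℝ) with hN
  have hN' : N = (n : ℝ) - 1 := by rw [hN]; push_cast [Nat.cast_sub (show 1 ≤ n by omega)]; ring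
  have hN1 : 1 ≤ N := by rw [hN]; exact_mod_cast (show 1 ≤ n - 1 by omega)
  set M : ℝ := ((k - n : ℕ) : ℝ) with hM
  have hM' : M = (k : ℝ) - n := by rw [hM]; push_cast [Nat.cast_sub hk]; ring
  have hM0 : 0 ≤ M := Nat.cast_nonneg _
  -- After multiplication by N * v, the final inequality becomes c' + A * log h + B * log η < 0.
  -- Under log η ≤ -w * log h the decisive quantity is w * B - A, whose positivity is `hlwv`.
  set B := (1 + l) * (v - 1) - l * N * v with hB
  set A := v * ((1 + l) * M + l * N) with hA
  have hA0 : 0 ≤ A := by positivity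
  have hgap : 0 < w * B - A := by
    have : w * B - A = (w * v - w + ((n : ℝ) - k) * v) -
        l * (((n : ℝ) - 2) * w * v + w + ((k : ℝ) - 1) * v) := by
      rw [hB, hA, hN', hM']; ring
    linarith
  set c := Real.log (2 * K)
  have hc0 : 0 ≤ c := Real.log_nonneg (by linarith)
  have hlog2 : 0 < Real.log 2 := Real.log_pos (by norm_num)
  set c' := v * (1 + l) * (N * Real.log N + c) + (1 + l) * Real.log 2 with hc'
  refine ⟨Real.exp (|c'| / (w * B - A) + 1), Real.one_lt_exp_iff.2 (by positivity),
    fun h η hh hη hηw hη1 => ?_⟩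
  have hh0 : 0 < h := (Real.exp_pos _).trans_le hh
  set L := Real.log h with hL
  set E := Real.log η with hE
  have hLlow : |c'| / (w * B - A) + 1 ≤ L := (Real.le_log_iff_exp_le hh0).2 hh
  have hL0 : 0 < L := lt_of_lt_of_le (by positivity) hLlow
  have hE0 : E ≤ 0 := Real.log_nonpos hη.le hη1
  have hEL : E ≤ -w * L := by
    have := Real.log_le_log hη hηw
    rwa [Real.log_rpow hh0] at this
  -- Here d = log δ, chosen so that δ^(n-1) is exactly twice the left side of the smallness
  -- condition.
  set d := (c + M * L + E + (Real.log 2 - E) / v) / N with hd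
  have hNd : N * d = c + M * L + E + (Real.log 2 - E) / v := by
    rw [hd]; field_simp
  have hlog : Real.log N + d + l * (Real.log N + d + L - E) < 0 := by
    have hB0 : 0 < B := pos_of_mul_pos_right (show 0 < w * B by linarith) hw.le
    have hEB : E * B ≤ -w * L * B := mul_le_mul_of_nonneg_right hEL hB0.le
    have hLg : |c'| < L * (w * B - A) := by
      rw [← div_lt_iff₀ hgap]; linarith
    have hle := le_abs_self c'
    have hid : N * v * (Real.log N + d + l * (Real.log N + d + L - E)) =
        c' + A * L + B * E := by
      have h2 : N * v * (Real.log N + d + l * (Real.log N + d + L - E)) =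
        N * v * (1 + l) * Real.log N + (1 + l) * v * (N * d) + l * N * v * (L - E) := by ring
      rw [h2, hNd, hc', hA, hB]
      field_simp
      ring
    have hneg : N * v * (Real.log N + d + l * (Real.log N + d + L - E)) < 0 := by
      rw [hid]
      nlinarith
    by_contra! hcon
    exact absurd hneg (not_lt.2 (mul_nonneg (by positivity) hcon))
  -- This is δ ≥ η, whence δ * h / η ≥ h; it follows from E ≤ N * d because E ≤ 0 and N ≥ 1.
  have hdE : E ≤ d := by
    have h2 : E ≤ N * d := by
      rw [hNd]
      have : 0 ≤ (Real.log 2 - E) / v := div_nonneg (by linarith) hv0.le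
      have : 0 ≤ M * L := by positivity
      linarith
    by_contra! hlt
    nlinarith
  have hηE : η = Real.exp E := (Real.exp_log hη).symm
  have hhL : h = Real.exp L := (Real.exp_log hh0).symm
  have hX : Real.exp d * h / η = Real.exp (d + L - E) := by
    rw [Real.exp_sub, Real.exp_add, ← hηE, ← hhL]
  refine ⟨Real.exp d, Real.exp_pos _, ?_, ?_, ?_⟩
  · rw [hX]
    nth_rewrite 1 [hhL]
    exact Real.exp_le_exp.2 (by linarith)
  · have h2 : Real.exp d ^ (n - 1) = 2 * (K * h ^ (k - n) * η * (2 / η) ^ v⁻¹) := by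
      rw [← Real.exp_nat_mul, hNd, Real.exp_add, Real.exp_add, Real.exp_add,
        Real.exp_log (by positivity), ← hηE, hM, Real.exp_nat_mul, ← hhL,
        Real.rpow_def_of_pos (by positivity), Real.log_div (by norm_num) hη.ne',
        div_eq_mul_inv (Real.log 2 - E)]
      ring
    rw [h2]
    have : 0 < K * h ^ (k - n) * η * (2 / η) ^ v⁻¹ := by positivity
    linarith
  · have hNe : N = Real.exp (Real.log N) := (Real.exp_log (by linarith)).symm
    rw [hX]
    rw [hNe, ← Real.exp_add, ← Real.exp_add, ← Real.exp_mul, Real.exp_lt_exp]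
    linarith

theorem frequently_simultaneousSolvable {n k : ℕ} (hn : 2 ≤ n) (hk : n ≤ k) {ξ l w v : ℝ}
    (hv : 1 < v) (hvw : v ≤ w) (hl : 0 ≤ l)
    (hlwv : l * (((n : ℝ) - 2) * w * v + w + ((k : ℝ) - 1) * v) <
      w * v - w + ((n : ℝ) - k) * v)
    (hw : ∃ᶠ X in atTop, LinearFormSolvable (veronese n ξ) w X)
    (hvev : ∀ᶠ X in atTop, LinearFormSolvable (veronese n ξ) v X) :
    ∃ᶠ X in atTop, SimultaneousSolvable (veronese k ξ) l X := by
  have hv0 : 0 < v := by linarith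
  have hw0 : 0 < w := by linarith
  have hC := one_le_powerBound k ξ
  obtain ⟨h₀, hh₀, hpar⟩ := exists_parameter hn hk hw0
    (K := ((k + 1).factorial : ℝ) * powerBound k ξ ^ (k - n + 2)) hv hl
    (one_le_mul_of_one_le_of_one_le
      (by exact_mod_cast Nat.factorial_pos (k + 1)) (one_le_pow₀ hC)) hlwv
  obtain ⟨X₁, hX₁⟩ := eventually_atTop.1 hvev
  rw [frequently_atTop] at hw ⊢
  intro a
  obtain ⟨h, hha, hsol⟩ := hw (max a (max h₀ X₁))
  have ha : a ≤ h := (le_max_left _ _).trans hha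
  have hhh : h₀ ≤ h := (le_max_left _ _).trans ((le_max_right _ _).trans hha)
  have hhX : X₁ ≤ h := (le_max_right _ _).trans ((le_max_right _ _).trans hha)
  have h1 : 1 < h := hh₀.trans_le hhh
  -- The factor 2 in H turns the non-strict bound H^(-v) into the strict inequality |Q(ξ)| < η.
  have hHv : ∀ η : ℝ, 0 < η → ((2 / η) ^ v⁻¹ : ℝ) ^ (-v) = η / 2 := by
    intro η hη
    rw [← Real.rpow_mul (by positivity), mul_neg, inv_mul_cancel₀ hv0.ne', Real.rpow_neg_one,
      inv_div]
  obtain ⟨P, Q, hPdeg, hQdeg, hPh, hPpos, hPle, hQh, hQη, hind⟩ :=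
    exists_polynomial_pair hn hk h1 hw0 hsol (fun η => (2 / η) ^ v⁻¹) (by
      intro η hη hηh
      -- The hypothesis v ≤ w is used here; it places H in the range where uniform solvability
      -- holds.
      have hH : h ≤ (2 / η) ^ v⁻¹ := by
        rw [Real.le_rpow_inv_iff_of_pos (by linarith) (by positivity) hv0, le_div_iff₀ hη]
        calc h ^ v * η ≤ h ^ w * h ^ (-w) := by
              gcongr
              exact h1.le
          _ = 1 := by
              rw [← Real.rpow_add (by linarith)]
              simp
          _ ≤ 2 := by norm_num
      refine ⟨hH, ?_⟩
      obtain ⟨Q, hQ1, hQ2, hQ3, hQ4⟩ :=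
        LinearFormSolvable.exists_polynomial (by positivity) (hX₁ _ (hhX.trans hH))
      rw [hHv η hη] at hQ4
      exact ⟨Q, hQ1, hQ2, hQ3, by linarith⟩)
  set η := |Polynomial.aeval ξ P| with hη
  have hη1 : η ≤ 1 :=
    hPle.trans (Real.rpow_le_one_of_one_le_of_nonpos h1.le (by linarith))
  obtain ⟨δ, hδ, hXh, hsmall, hfin⟩ := hpar h η hhh hPpos hPle hη1
  have hH : h ≤ (2 / η) ^ v⁻¹ := by
    rw [Real.le_rpow_inv_iff_of_pos (by linarith) (by positivity) hv0, le_div_iff₀ hPpos]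
    calc h ^ v * η ≤ h ^ w * h ^ (-w) := by
          gcongr
          exact h1.le
      _ = 1 := by
          rw [← Real.rpow_add (by linarith)]
          simp
      _ ≤ 2 := by norm_num
  obtain ⟨z, hz0, hzX, hzδ⟩ := exists_int_vector_of_polynomials hn hk (X₀ := δ * h / η) h1.le hPpos
    hη1 hδ hPdeg hQdeg hPh rfl hH hQh hQη hind (by field_simp) hsmall
  have hN1 : (1 : ℝ) ≤ (n - 1 : ℕ) := by exact_mod_cast (show 1 ≤ n - 1 by omega)
  have hXge : h ≤ (n - 1 : ℕ) * (δ * h / η) := hXh.trans (le_mul_of_one_le_left (by linarith) hN1)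
  have hle1 : ((n - 1 : ℕ) * (δ * h / η)) ^ (-l) ≤ 1 :=
    Real.rpow_le_one_of_one_le_of_nonpos (by linarith) (by linarith)
  refine ⟨_, ha.trans hXge, z 0, fun j => z j.succ, ?_, hzX, fun j => (hzδ j).trans hfin.le⟩
  -- If z 0 = 0, the other coordinates are integers of absolute value at most (n-1) * δ < 1, so z =
  -- 0.
  have hz00 : z 0 ≠ 0 := by
    intro h0
    apply hz0
    ext j
    refine Fin.cases h0 (fun j => ?_) j
    have h2 := hzδ j
    rw [h0, Int.cast_zero, mul_zero, zero_sub, abs_neg] at h2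
    have h3 : |(z j.succ : ℝ)| < 1 := by linarith
    have h4 : |z j.succ| < 1 := by exact_mod_cast h3
    exact Int.abs_lt_one_iff.1 h4
  exact_mod_cast Int.one_le_abs hz00

theorem lambdaExp_nonneg (k : ℕ) (ξ : ℝ) : 0 ≤ lambdaExp k ξ := by
  refine le_iSup₂_of_le (0 : ℝ) (Eventually.frequently ?_) le_rfl
  filter_upwards [eventually_ge_atTop 1] with X hX
  refine ⟨1, fun j => round (veronese k ξ j), by simp, by simpa using hX, fun j => ?_⟩
  have := abs_sub_round (veronese k ξ j)
  simp only [Int.cast_one, mul_one, neg_zero, Real.rpow_zero]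
  linarith

theorem wHatExp_nonneg (n : ℕ) (ξ : ℝ) : 0 ≤ wHatExp n ξ := by
  refine le_iSup₂_of_le (0 : ℝ) ?_ le_rfl
  filter_upwards [eventually_ge_atTop 0] with X hX
  exact ⟨1, 0, fun _ => by simpa using hX, by simp, by simp⟩

theorem wHatExp_le_wExp (n : ℕ) (ξ : ℝ) : wHatExp n ξ ≤ wExp n ξ :=
  iSup₂_le fun w hw => le_iSup₂_of_le w hw.frequently le_rfl

/-- Suprema need not be attained, so the inequality is demanded for all real pairs just below the
exponents. Replacing w by max w v secures v ≤ w. -/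
theorem le_lambdaExp_of_exponents {n k : ℕ} (hn : 2 ≤ n) (hk : n ≤ k) {ξ l w₀ v₀ : ℝ}
    (hl : 0 ≤ l) (hw₀ : (w₀ : EReal) < wExp n ξ) (hv₀ : (v₀ : EReal) < wHatExp n ξ)
    (h : ∀ w v : ℝ, w₀ < w → (w : EReal) ≤ wExp n ξ → v₀ < v → (v : EReal) ≤ wHatExp n ξ →
      1 < v ∧ l * (((n : ℝ) - 2) * w * v + w + ((k : ℝ) - 1) * v) <
        w * v - w + ((n : ℝ) - k) * v) :
    (l : EReal) ≤ lambdaExp k ξ := by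
  obtain ⟨v, hv⟩ := lt_iSup_iff.1 hv₀
  obtain ⟨hvev, hv⟩ := lt_iSup_iff.1 hv
  obtain ⟨w, hw⟩ := lt_iSup_iff.1 hw₀
  obtain ⟨hwfr, hw⟩ := lt_iSup_iff.1 hw
  have hmax : ∃ᶠ X in atTop, LinearFormSolvable (veronese n ξ) (max w v) X := by
    rcases max_choice w v with h | h <;> rw [h]
    · exact hwfr
    · exact hvev.frequently
  obtain ⟨h1, h2⟩ := h (max w v) v (lt_max_of_lt_left (EReal.coe_lt_coe_iff.1 hw))
    (le_iSup₂_of_le _ hmax le_rfl) (EReal.coe_lt_coe_iff.1 hv) (le_iSup₂_of_le _ hvev le_rfl)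
  exact le_iSup₂_of_le l
    (frequently_simultaneousSolvable hn hk h1 (le_max_right _ _) hl h2 hmax hvev) le_rfl

theorem mainTheorem3 (n k : ℕ) (hn : 2 ≤ n) (hk : n ≤ k) (ξ : ℝ) :
    DiophantineExponent.mixedBound n k
        (DiophantineExponent.wExp n ξ) (DiophantineExponent.wHatExp n ξ) ≤
      DiophantineExponent.lambdaExp k ξ := by
  refine le_of_forall_lt_imp_le_of_dense fun a ha => ?_
  rcases le_or_gt a 0 with ha0 | ha0
  · exact ha0.trans (lambdaExp_nonneg k ξ)
  induction a with
  | bot => exact bot_le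
  | top => exact absurd ha not_top_lt
  | coe l =>
  have hl : 0 < l := by exact_mod_cast ha0
  have hn2 : (0 : ℝ) ≤ (n : ℝ) - 2 := sub_nonneg.2 (by exact_mod_cast hn)
  have hkn : (0 : ℝ) ≤ (k : ℝ) - n := sub_nonneg.2 (by exact_mod_cast hk)
  have hk1 : (0 : ℝ) ≤ (k : ℝ) - 1 := by linarith
  have hV0 := wHatExp_nonneg n ξ
  have hVW := wHatExp_le_wExp n ξ
  have hW0 := hV0.trans hVW
  -- With D and c the inequality takes the form D * v < w * (c * v - (1 + l)), where the limits in w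
  -- and v can be read off.
  set D := l * ((k : ℝ) - 1) + ((k : ℝ) - n) with hD
  have hD0 : 0 ≤ D := by positivity
  set c := 1 - l * ((n : ℝ) - 2) with hc
  have hc1 : c ≤ 1 := by
    have : 0 ≤ l * ((n : ℝ) - 2) := by positivity
    linarith
  have hreform : ∀ w v : ℝ, D * v < w * (c * v - (1 + l)) →
      l * (((n : ℝ) - 2) * w * v + w + ((k : ℝ) - 1) * v) < w * v - w + ((n : ℝ) - k) * v := by
    intro w v h
    rw [hD, hc] at h
    linarith
  unfold mixedBound at ha
  by_cases hV : wHatExp n ξ = ⊤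
  · have hW : wExp n ξ = ⊤ := top_le_iff.1 (hV ▸ hVW)
    have hc0 : 0 < c := by
      rw [if_pos hV] at ha
      split_ifs at ha with h2
      · simp [hc, h2]
      · have h3 : l < 1 / ((n : ℝ) - 2) := by exact_mod_cast ha
        have h4 : 0 < (n : ℝ) - 2 :=
          lt_of_le_of_ne hn2 fun h => h2 (by exact_mod_cast (sub_eq_zero.1 h.symm))
        rw [lt_div_iff₀ h4] at h3
        linarith
    -- The choice of v₀ gives c * v - (1 + l) > c * v / 2, and w₀ then gives w * c / 2 > D.
    refine le_lambdaExp_of_exponents hn hk hl.le (w₀ := 2 * D / c) (v₀ := 2 * (1 + l) / c)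
      (hW ▸ EReal.coe_lt_top _) (hV ▸ EReal.coe_lt_top _) fun w v hw _ hv _ => ?_
    rw [div_lt_iff₀ hc0] at hw hv
    have hv1 : 1 < v := by
      by_contra! h
      nlinarith
    refine ⟨hv1, hreform w v ?_⟩
    have hw0 : 0 < w := by
      by_contra! h
      nlinarith
    nlinarith
  rw [if_neg hV] at ha
  obtain ⟨v, hv⟩ : ∃ v : ℝ, wHatExp n ξ = v :=
    ⟨_, (EReal.coe_toReal hV (ne_bot_of_le_ne_bot EReal.zero_ne_bot hV0)).symm⟩
  rw [hv] at hV0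
  have hv0 : 0 ≤ v := by exact_mod_cast hV0
  by_cases hW : wExp n ξ = ⊤
  · rw [if_pos hW, hv, EReal.toReal_coe, EReal.coe_lt_coe_iff,
      lt_div_iff₀ (by positivity)] at ha
    have hcv : 1 + l < c * v := by rw [hc]; linarith
    have hc0 : 0 < c := pos_of_mul_pos_left (lt_trans (by linarith) hcv) hv0
    have hlt : (1 + l) / c < v := by rwa [div_lt_iff₀ hc0, mul_comm]
    obtain ⟨v₀, hv₀, hv₀v⟩ := exists_between hlt
    rw [div_lt_iff₀ hc0] at hv₀
    set ε := v₀ * c - (1 + l) with hε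
    have hε0 : 0 < ε := by linarith
    refine le_lambdaExp_of_exponents hn hk hl.le (w₀ := D * v / ε) (v₀ := v₀)
      (hW ▸ EReal.coe_lt_top _) (by rw [hv]; exact_mod_cast hv₀v) fun w v' hw _ hv' hv'v => ?_
    rw [hv, EReal.coe_le_coe_iff] at hv'v
    have hw0 : 0 < w := lt_of_le_of_lt (by positivity) hw
    rw [div_lt_iff₀ hε0] at hw
    have hε' : ε ≤ c * v' - (1 + l) := by nlinarith
    refine ⟨?_, hreform w v' ?_⟩
    · by_contra! h
      nlinarith
    · calc D * v' ≤ D * v := by gcongr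
        _ < w * ε := hw
        _ ≤ _ := by gcongr
  · obtain ⟨w, hw⟩ : ∃ w : ℝ, wExp n ξ = w :=
      ⟨_, (EReal.coe_toReal hW (ne_bot_of_le_ne_bot EReal.zero_ne_bot hW0)).symm⟩
    rw [hw] at hW0
    have hw0 : 0 ≤ w := by exact_mod_cast hW0
    rw [if_neg hW, hv, hw, EReal.toReal_coe, EReal.toReal_coe, EReal.coe_lt_coe_iff] at ha
    -- A zero denominator makes the quotient 0 by convention, contradicting l > 0; this covers w = v
    -- = 0.
    have hden : 0 < ((n : ℝ) - 2) * w * v + w + ((k : ℝ) - 1) * v := by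
      refine lt_of_le_of_ne (by positivity) fun h => ?_
      rw [← h, div_zero] at ha
      linarith
    rw [lt_div_iff₀ hden] at ha
    have hv1 : 1 < v := by
      by_contra! h
      have h1 : w * (v - 1) ≤ 0 := mul_nonpos_of_nonneg_of_nonpos hw0 (by linarith)
      have h2 : 0 ≤ ((k : ℝ) - n) * v := by positivity
      have h3 := mul_pos hl hden
      linarith
    -- Both conditions are strict and continuous, so they persist for pairs close to (w, v).
    have hopen : IsOpen {p : ℝ × ℝ | 1 < p.2 ∧
        l * (((n : ℝ) - 2) * p.1 * p.2 + p.1 + ((k : ℝ) - 1) * p.2) <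
          p.1 * p.2 - p.1 + ((n : ℝ) - k) * p.2} := by
      rw [Set.ofPred_and]
      refine IsOpen.inter (isOpen_lt ?_ ?_) (isOpen_lt ?_ ?_) <;> fun_prop
    obtain ⟨ε, hε, hball⟩ := Metric.isOpen_iff.1 hopen (w, v) ⟨hv1, ha⟩
    refine le_lambdaExp_of_exponents hn hk hl.le (w₀ := w - ε) (v₀ := v - ε)
      (by rw [hw, EReal.coe_lt_coe_iff]; linarith) (by rw [hv, EReal.coe_lt_coe_iff]; linarith)
      fun w' v' hw' hw'w hv' hv'v => ?_
    rw [hw, EReal.coe_le_coe_iff] at hw'w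
    rw [hv, EReal.coe_le_coe_iff] at hv'v
    refine hball (show (w', v') ∈ Metric.ball (w, v) ε from ?_)
    rw [Metric.mem_ball, Prod.dist_eq, max_lt_iff, Real.dist_eq, Real.dist_eq, abs_lt, abs_lt]
    exact ⟨⟨by dsimp; linarith, by dsimp; linarith⟩, ⟨by dsimp; linarith, by dsimp; linarith⟩⟩

end Exponents
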